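/- Let $1\le Q\le d$ and $n\ge 1$ be integers. For a partition $\mathcal G$ of $\{1,\dots,d\}$ into exactly $Q$ nonempty groups let $\mathcal U_{\mathcal G}=\{Zv : Z \text{ an assignment matrix of } \mathcal G,\ v\in\mathbb R^Q\}\subset\mathbb R^d$, where an assignment matrix of $\mathcal G$ is a matrix in $\{0,1\}^{d\times Q}$ whose columns are the indicator vectors of the groups of $\mathcal G$ in some order (so $\mathcal U_{\mathcal G}$ is the subspace of vectors that are constant on every group). Let $\mathcal P_Q$ be the set of these partitions and put \[ \mathcal E_1=\{\mathcal U_{\mathcal G} : \mathcal G\in\mathcal P_Q\},\quad \mathcal E_2=\{\mathcal U_{\mathcal G_1}+\mathcal U_{\mathcal G_2} : \mathcal G_1,\mathcal G_2\in\mathcal P_Q\},\quad \mathcal E_3=\{\mathcal U_{\mathcal G_1}+\mathcal U_{\mathcal G_2}+\mathcal U_{\mathcal G_3} : \mathcal G_1,\mathcal G_2,\mathcal G_3\in\mathcal P_Q\}, \] $D=\max_{\mathcal U\in\mathcal E_1}\dim\mathcal U$ and $N=\mathrm{Card}(\mathcal E_1)$. A random vector $x$ in $\mathbb R^d$ is isotropic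 if $\mathbb E[xx^T]=I$, and its sub-gaussian norm is $\|x\|_{\psi_2}=\sup_{\|\theta\|_2=1}\sup_{p\ge 1}p^{-1/2}\big(\mathbb E|\langle x,\theta\rangle|^p\big)^{1/p}$. For every $K\ge 0$ there are constants $C_0,c>0$ depending only on $K$ such that the following holds for all $d,Q,n$ as above. Let $X\in\mathbb R^{n\times d}$ be a random matrix whose rows $x_1,\dots,x_n$ are independent isotropic random vectors with $\|x_i\|_{\psi_2}\le K$ for all $i$, let $\epsilon\ge 0$, and for $p=2,3$ let \[ \delta_p=C_0\sqrt{\frac{pD}{n}}+\sqrt{\frac{1+p\log N}{cn}} . \] Then, with probability at least $1-\exp(-c\epsilon^2n)$, both \[ \frac1{\sqrt n}\max_{\mathcal U\in\mathcal E_2}\|X\Pi_{\mathcal U}\|_2\le 1+\delta_2+\epsilon \quad\text{and}\quad \max_{\mathcal U\in\mathcal E_3}\Big\|I-\frac1n\Pi_{\mathcal U}^TX^TX\Pi_{\mathcal U}\Big\|_2\le 3\max\{\delta_3+\epsilon,(\delta_3+\epsilon)^2\} \] hold, where $\|\cdot\|_2$ is the spectral norm and $\Pi_{\mathcal U}$ is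 a matrix whose columns form any orthonormal basis of $\mathcal U$. -/

import Mathlib

open MeasureTheory ProbabilityTheory
open scoped ENNReal NNReal Matrix.Norms.L2Operator

noncomputable section

namespace ClusteredDesign

/-! ### Subspaces generated by partitions of the features -/

/-- `Z` is an assignment matrix of the partition `G` of the `d` features: its columns are the
indicator vectors of the groups of `G`, listed in some order. -/
def IsAssignmentMatrix {d : ℕ} (G : Finpartition (Finset.univ : Finset (Fin d)))
    (Z : Matrix (Fin d) (Fin G.parts.card) ℝ) : Prop :=
  ∃ e : Fin G.parts.card ≃ {g // g ∈ G.parts},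
    ∀ i q, Z i q = if i ∈ (e q : Finset (Fin d)) then 1 else 0

/-- The vectors `Z v` with `Z` an assignment matrix of `G` are exactly the vectors that are constant
on every group of `G`. -/
theorem exists_assignment_iff {d : ℕ} (G : Finpartition (Finset.univ : Finset (Fin d)))
    (w : EuclideanSpace ℝ (Fin d)) :
    (∃ Z, IsAssignmentMatrix G Z ∧ ∃ v : Fin G.parts.card → ℝ, ∀ i, w i = (Z.mulVec v) i) ↔
      ∀ g ∈ G.parts, ∀ i ∈ g, ∀ j ∈ g, w i = w j := by
  have key : ∀ (e : Fin G.parts.card ≃ {g // g ∈ G.parts}) (v : Fin G.parts.card → ℝ)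
      (q : Fin G.parts.card) (i : Fin d), i ∈ (e q : Finset (Fin d)) →
      (∑ q', (if i ∈ (e q' : Finset (Fin d)) then (1 : ℝ) else 0) * v q') = v q := by
    intro e v q i hi
    rw [Finset.sum_eq_single q]
    · simp [hi]
    · intro q' _ hne
      have : i ∉ (e q' : Finset (Fin d)) := by
        intro hi'
        apply hne
        apply e.injective
        apply Subtype.ext
        exact G.eq_of_mem_parts (e q').2 (e q).2 hi' hi
      simp [this]
    · simp
  constructor
  · rintro ⟨Z, ⟨e, hZ⟩, v, hw⟩ g hg i hi j hj
    have hq : (e (e.symm ⟨g, hg⟩) : Finset (Fin d)) = g := by simp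
    rw [hw, hw]
    simp only [Matrix.mulVec, dotProduct, hZ]
    rw [key e v (e.symm ⟨g, hg⟩) i (by rwa [hq]), key e v (e.symm ⟨g, hg⟩) j (by rwa [hq])]
  · intro h
    let e := G.parts.equivFin.symm
    have hne : ∀ q, ((e q : Finset (Fin d))).Nonempty := fun q =>
      G.nonempty_of_mem_parts (e q).2
    refine ⟨fun i q => if i ∈ (e q : Finset (Fin d)) then 1 else 0, ⟨e, fun _ _ => rfl⟩,
      fun q => w (hne q).choose, fun i => ?_⟩
    obtain ⟨g, hg, hi⟩ := G.exists_mem (Finset.mem_univ i)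
    have hq : (e (e.symm ⟨g, hg⟩) : Finset (Fin d)) = g := by simp
    simp only [Matrix.mulVec, dotProduct]
    rw [key e _ (e.symm ⟨g, hg⟩) i (by rwa [hq])]
    refine h g hg i hi _ ?_
    have := (hne (e.symm ⟨g, hg⟩)).choose_spec
    exact (Finset.ext_iff.mp hq _).mp this

/-- The subspace `𝒰_G = {w : w = Z v, Z an assignment matrix of G}` of `ℝ^d`. -/
def partitionSubspace {d : ℕ} (G : Finpartition (Finset.univ : Finset (Fin d))) :
    Submodule ℝ (EuclideanSpace ℝ (Fin d)) where
  carrier := {w | ∃ Z, IsAssignmentMatrix G Z ∧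
    ∃ v : Fin G.parts.card → ℝ, ∀ i, w i = (Z.mulVec v) i}
  add_mem' := by
    intro a b ha hb
    rw [Set.mem_ofPred_eq, exists_assignment_iff] at *
    intro g hg i hi j hj
    simp [ha g hg i hi j hj, hb g hg i hi j hj]
  zero_mem' := by
    rw [Set.mem_ofPred_eq, exists_assignment_iff]
    simp
  smul_mem' := by
    intro r a ha
    rw [Set.mem_ofPred_eq, exists_assignment_iff] at *
    intro g hg i hi j hj
    simp [ha g hg i hi j hj]

/-- Partitions of the `d` features into exactly `Q` (nonempty) groups. -/
def partitionsInto (d Q : ℕ) : Set (Finpartition (Finset.univ : Finset (Fin d))) :=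
  {G | G.parts.card = Q}

/-- The collection `ℰ₁`. -/
def E1 (d Q : ℕ) : Set (Submodule ℝ (EuclideanSpace ℝ (Fin d))) :=
  {U | ∃ G ∈ partitionsInto d Q, U = partitionSubspace G}

/-- The collection `ℰ₂`. -/
def E2 (d Q : ℕ) : Set (Submodule ℝ (EuclideanSpace ℝ (Fin d))) :=
  {U | ∃ G₁ ∈ partitionsInto d Q, ∃ G₂ ∈ partitionsInto d Q,
    U = partitionSubspace G₁ ⊔ partitionSubspace G₂}

/-- The collection `ℰ₃`. -/
def E3 (d Q : ℕ) : Set (Submodule ℝ (EuclideanSpace ℝ (Fin d))) :=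
  {U | ∃ G₁ ∈ partitionsInto d Q, ∃ G₂ ∈ partitionsInto d Q, ∃ G₃ ∈ partitionsInto d Q,
    U = partitionSubspace G₁ ⊔ partitionSubspace G₂ ⊔ partitionSubspace G₃}

/-- `ℰ₁` is finite, so its cardinality and the maximal dimension below are genuine. -/
theorem E1_finite (d Q : ℕ) : (E1 d Q).Finite := by
  refine ((Set.toFinite (partitionsInto d Q)).image partitionSubspace).subset ?_
  rintro U ⟨G, hG, rfl⟩
  exact ⟨G, hG, rfl⟩

/-- `D`, the maximal dimension of a subspace in `ℰ₁`. -/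
def maxDim (d Q : ℕ) : ℕ :=
  sSup ((fun U : Submodule ℝ (EuclideanSpace ℝ (Fin d)) => Module.finrank ℝ U) '' E1 d Q)

/-- `N`, the number of subspaces in `ℰ₁`. -/
def numSubspaces (d Q : ℕ) : ℕ := (E1 d Q).ncard

/-- `δ_p = C₀ √(p D / n) + √((1 + p log N) / (c n))`. -/
def delta (C₀ c : ℝ) (d Q n p : ℕ) : ℝ :=
  C₀ * √((p * maxDim d Q : ℝ) / n) + √((1 + p * Real.log (numSubspaces d Q)) / (c * n))

/-- The matrix whose columns are the vectors of an orthonormal basis of `U`. -/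
def basisMatrix {d m : ℕ} {U : Submodule ℝ (EuclideanSpace ℝ (Fin d))}
    (b : OrthonormalBasis (Fin m) ℝ U) : Matrix (Fin d) (Fin m) ℝ :=
  Matrix.of fun i j => (b j : EuclideanSpace ℝ (Fin d)) i

/-! ### Random vectors -/

/-- The matrix with rows `x i`. -/
def designMatrix {n d : ℕ} (x : Fin n → EuclideanSpace ℝ (Fin d)) : Matrix (Fin n) (Fin d) ℝ :=
  Matrix.of fun i j => x i j

/-- The sub-gaussian norm `sup_{p ≥ 1} p^{-1/2} (E |Y|^p)^{1/p}` of a real random variable, with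
values in `[0, ∞]`. -/
def psi2Norm {Ω : Type*} [MeasurableSpace Ω] (Y : Ω → ℝ) (μ : Measure Ω) : ℝ≥0∞ :=
  ⨆ (p : ℝ) (_ : 1 ≤ p), ENNReal.ofReal p ^ (-(1 / 2) : ℝ) * eLpNorm Y (ENNReal.ofReal p) μ

/-- The sub-gaussian norm of a random vector: the supremum of the sub-gaussian norms of its
one-dimensional marginals in unit directions. The vector is sub-gaussian iff this is finite. -/
def vectorPsi2Norm {Ω : Type*} [MeasurableSpace Ω] {d : ℕ} (x : Ω → EuclideanSpace ℝ (Fin d))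
    (μ : Measure Ω) : ℝ≥0∞ :=
  ⨆ (θ : EuclideanSpace ℝ (Fin d)) (_ : ‖θ‖ = 1), psi2Norm (fun ω => inner ℝ (x ω) θ) μ

/-- Isotropy: `E[x xᵀ]` is the identity matrix. -/
def IsIsotropic {Ω : Type*} [MeasurableSpace Ω] {d : ℕ} (x : Ω → EuclideanSpace ℝ (Fin d))
    (μ : Measure Ω) : Prop :=
  ∀ j k : Fin d, Integrable (fun ω => x ω j * x ω k) μ ∧
    ∫ ω, x ω j * x ω k ∂μ = (1 : Matrix (Fin d) (Fin d) ℝ) j k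

end ClusteredDesign

end

open ClusteredDesign

universe u

/-!
For a fixed unit vector `θ` the variables `⟪xᵢ, θ⟫² - 1` are independent and centred, and the
sub-gaussian bound makes their moment generating functions dominated by Gaussian ones near `0`, so
their mean satisfies a Bernstein inequality. The operator `I - n⁻¹ ∑ᵢ yᵢ ⊗ yᵢ`, where `yᵢ` is the
projection of `xᵢ` to a subspace `U`, is controlled by its quadratic form on a `1/4`-net of the unit
sphere of `U`, which has at most `9 ^ dim U` points. A union bound over these points and over the at
most `N ^ p` sums of `p` subspaces, each of dimension at most `p D`, costs `p D log 9 + p log N` in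
the exponent; the two terms of `δ_p` are chosen so that `n (δ_p + ε)²` pays for it and still leaves
a multiple of `ε² n`. In an orthonormal basis of `U` the operator is `I - n⁻¹ AᵀA` with `A = X Π`,
which is the second bound, and the first follows from `‖A‖² = ‖AᵀA‖`.
-/

noncomputable section

namespace ClusteredDesign

section Bernstein

variable {Ω : Type*} [MeasurableSpace Ω] {μ : Measure Ω} {X : Ω → ℝ} {v b : ℝ}

/-- The moment generating function of `X` is finite on `[-b, b]` and is dominated there by that of
a centred Gaussian variable of variance `v`: the hypothesis of Bernstein's inequality. -/
structure HasSubexponentialMGF (X : Ω → ℝ) (v b : ℝ) (μ : Measure Ω) : Prop where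
  integrable_exp_mul : ∀ t, |t| ≤ b → Integrable (fun ω => Real.exp (t * X ω)) μ
  mgf_le : ∀ t, |t| ≤ b → mgf X μ t ≤ Real.exp (v * t ^ 2 / 2)

namespace HasSubexponentialMGF

theorem neg (h : HasSubexponentialMGF X v b μ) : HasSubexponentialMGF (-X) v b μ where
  integrable_exp_mul t ht := by
    simpa using h.integrable_exp_mul (-t) (by rwa [abs_neg])
  mgf_le t ht := by
    simpa [mgf_neg] using h.mgf_le (-t) (by rwa [abs_neg])

variable [IsFiniteMeasure μ]

theorem sum_of_iIndepFun {ι : Type*} {Y : ι → Ω → ℝ} {w : ι → ℝ} (hind : iIndepFun Y μ)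
    (hmeas : ∀ i, Measurable (Y i)) {s : Finset ι}
    (h : ∀ i ∈ s, HasSubexponentialMGF (Y i) (w i) b μ) :
    HasSubexponentialMGF (∑ i ∈ s, Y i) (∑ i ∈ s, w i) b μ where
  integrable_exp_mul t ht :=
    hind.integrable_exp_mul_sum hmeas fun i hi => (h i hi).integrable_exp_mul t ht
  mgf_le t ht := by
    rw [hind.mgf_sum hmeas, Finset.sum_mul, Finset.sum_div, Real.exp_sum]
    exact Finset.prod_le_prod (fun i _ => mgf_nonneg) fun i hi => (h i hi).mgf_le t ht

theorem measureReal_ge_le (h : HasSubexponentialMGF X v b μ) (s : ℝ) {l : ℝ} (hl : 0 ≤ l)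
    (hlb : l ≤ b) : μ.real {ω | s ≤ X ω} ≤ Real.exp (-l * s + v * l ^ 2 / 2) := by
  have hl' : |l| ≤ b := by rwa [abs_of_nonneg hl]
  rw [Real.exp_add]
  exact (measure_ge_le_exp_mul_mgf s hl (h.integrable_exp_mul l hl')).trans
    (mul_le_mul_of_nonneg_left (h.mgf_le l hl') (Real.exp_pos _).le)

theorem measureReal_abs_ge_le (h : HasSubexponentialMGF X v b μ) (s : ℝ) {l : ℝ} (hl : 0 ≤ l)
    (hlb : l ≤ b) : μ.real {ω | s ≤ |X ω|} ≤ 2 * Real.exp (-l * s + v * l ^ 2 / 2) := by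
  calc μ.real {ω | s ≤ |X ω|} ≤ μ.real ({ω | s ≤ X ω} ∪ {ω | s ≤ (-X) ω}) :=
        measureReal_mono fun ω hω => by simpa [le_abs] using hω
    _ ≤ μ.real {ω | s ≤ X ω} + μ.real {ω | s ≤ (-X) ω} := measureReal_union_le _ _
    _ ≤ 2 * Real.exp (-l * s + v * l ^ 2 / 2) := by
        linarith [h.measureReal_ge_le s hl hlb, h.neg.measureReal_ge_le s hl hlb]

theorem measureReal_abs_ge_max_sq_le {m a t : ℝ} (h : HasSubexponentialMGF X (m * v) b μ)
    (hm : 0 ≤ m) (ha : 0 ≤ a) (hab : a ≤ b) (hva : 2 * v * a ≤ 1) (ht : 0 ≤ t) :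
    μ.real {ω | m * (max t (t ^ 2) / 2) ≤ |X ω|} ≤ 2 * Real.exp (-(m * a * t ^ 2 / 4)) := by
  have : 0 ≤ min t 1 := le_min ht zero_le_one
  have hmin_mul_max : min t 1 * max t (t ^ 2) = t ^ 2 := by
    rcases le_total t 1 with h1 | h1
    · rw [min_eq_left h1, max_eq_left (by nlinarith), sq]
    · rw [min_eq_right h1, max_eq_right (by nlinarith), one_mul]
  refine (h.measureReal_abs_ge_le (m * (max t (t ^ 2) / 2)) (l := a * min t 1) (by positivity)
    ((mul_le_of_le_one_right ha (min_le_right _ _)).trans hab)).trans ?_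
  gcongr
  have hquad : m * v * (a * min t 1) ^ 2 / 2 ≤ m * a * t ^ 2 / 4 := by
    calc m * v * (a * min t 1) ^ 2 / 2 = 2 * v * a * (m * a * min t 1 ^ 2 / 4) := by ring
      _ ≤ 1 * (m * a * t ^ 2 / 4) := by
        gcongr
        exact min_le_left _ _
      _ = m * a * t ^ 2 / 4 := one_mul _
  have hlin : a * min t 1 * (m * (max t (t ^ 2) / 2)) = m * a * t ^ 2 / 2 := by
    calc a * min t 1 * (m * (max t (t ^ 2) / 2)) = m * a * (min t 1 * max t (t ^ 2)) / 2 := by ring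
      _ = m * a * t ^ 2 / 2 := by rw [hmin_mul_max]
  linarith

end HasSubexponentialMGF

end Bernstein

section SubgaussianSquare

variable {Ω : Type*} [MeasurableSpace Ω] {μ : Measure Ω} {K : ℝ≥0} {z : Ω → ℝ}

theorem eLpNorm_le_of_psi2Norm_le (hK : psi2Norm z μ ≤ K) {p : ℝ} (hp : 1 ≤ p) :
    eLpNorm z (ENNReal.ofReal p) μ ≤ ENNReal.ofReal (√p * K) := by
  have hp0 : 0 < p := by linarith
  have h : ENNReal.ofReal p ^ (-(1 / 2) : ℝ) * eLpNorm z (ENNReal.ofReal p) μ ≤ K :=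
    (le_iSup₂ (f := fun (p : ℝ) (_ : 1 ≤ p) =>
      ENNReal.ofReal p ^ (-(1 / 2) : ℝ) * eLpNorm z (ENNReal.ofReal p) μ) p hp).trans hK
  rw [ENNReal.ofReal_rpow_of_pos hp0, Real.rpow_neg hp0.le, ← Real.sqrt_eq_rpow,
    ENNReal.ofReal_inv_of_pos (by positivity),
    ENNReal.inv_mul_le_iff (ENNReal.ofReal_pos.2 (by positivity)).ne' ENNReal.ofReal_ne_top] at h
  rwa [ENNReal.ofReal_mul (by positivity), ENNReal.ofReal_coe_nnreal]

theorem memLp_of_psi2Norm_le (hz : AEStronglyMeasurable z μ) (hK : psi2Norm z μ ≤ K) {p : ℝ}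
    (hp : 1 ≤ p) : MemLp z (ENNReal.ofReal p) μ :=
  ⟨hz, (eLpNorm_le_of_psi2Norm_le hK hp).trans_lt ENNReal.ofReal_lt_top⟩

theorem integrable_sq_pow_of_psi2Norm_le [IsFiniteMeasure μ] (hz : AEStronglyMeasurable z μ)
    (hK : psi2Norm z μ ≤ K) (p : ℕ) : Integrable (fun ω => (z ω ^ 2) ^ p) μ := by
  rcases p.eq_zero_or_pos with rfl | hp
  · simp
  · have h := memLp_of_psi2Norm_le hz hK (p := (2 * p : ℕ)) (by norm_cast; lia)
    rw [ENNReal.ofReal_natCast] at h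
    simpa [pow_mul] using h.integrable_norm_pow (by lia)

theorem integral_sq_pow_le_of_psi2Norm_le (hz : AEStronglyMeasurable z μ)
    (hK : psi2Norm z μ ≤ K) {p : ℕ} (hp : 1 ≤ p) :
    ∫ ω, (z ω ^ 2) ^ p ∂μ ≤ (2 * p * K ^ 2) ^ p := by
  have h1 : (1 : ℝ) ≤ (2 * p : ℕ) := by norm_cast; lia
  have h0 : (0 : ℝ) < (2 * p : ℕ) := by linarith
  have hnorm : (∫ ω, ‖z ω‖ ^ ((2 * p : ℕ) : ℝ) ∂μ) ^ ((2 * p : ℕ) : ℝ)⁻¹ ≤ √(2 * p : ℕ) * K := by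
    have := eLpNorm_le_of_psi2Norm_le hK h1
    rwa [(memLp_of_psi2Norm_le hz hK h1).eLpNorm_eq_integral_rpow_norm
      (ENNReal.ofReal_pos.2 h0).ne' ENNReal.ofReal_ne_top,
      ENNReal.ofReal_le_ofReal_iff (by positivity), ENNReal.toReal_ofReal h0.le] at this
  calc ∫ ω, (z ω ^ 2) ^ p ∂μ = ∫ ω, ‖z ω‖ ^ ((2 * p : ℕ) : ℝ) ∂μ := by
        simp only [Real.rpow_natCast, pow_mul, Real.norm_eq_abs, sq_abs]
    _ ≤ (√(2 * p : ℕ) * K) ^ ((2 * p : ℕ) : ℝ) :=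
        (Real.rpow_inv_le_iff_of_pos (integral_nonneg fun _ => by positivity) (by positivity)
          h0).1 hnorm
    _ = (2 * p * K ^ 2) ^ p := by
        rw [Real.rpow_natCast, pow_mul, mul_pow _ (K : ℝ), Real.sq_sqrt h0.le]
        push_cast
        ring

theorem natCast_pow_div_factorial_le_three_pow (p : ℕ) : (p : ℝ) ^ p / p.factorial ≤ 3 ^ p := by
  refine (Real.pow_div_factorial_le_exp _ (Nat.cast_nonneg p) p).trans ?_
  rw [← Real.exp_one_pow]
  exact pow_le_pow_left₀ (Real.exp_pos 1).le (Real.exp_one_lt_d9.le.trans (by norm_num)) _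

theorem integral_abs_pow_div_factorial_le (hz : AEStronglyMeasurable z μ)
    (hK : psi2Norm z μ ≤ K) (l : ℝ) {p : ℕ} (hp : 1 ≤ p) :
    ∫ ω, |(l * z ω ^ 2) ^ p / p.factorial| ∂μ ≤ (6 * K ^ 2 * |l|) ^ p := by
  calc ∫ ω, |(l * z ω ^ 2) ^ p / p.factorial| ∂μ
      = |l| ^ p * (∫ ω, (z ω ^ 2) ^ p ∂μ) / p.factorial := by
        rw [← integral_const_mul, ← integral_div]
        simp [abs_mul, mul_pow, abs_div, abs_pow]
    _ ≤ |l| ^ p * (2 * p * K ^ 2) ^ p / p.factorial := by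
        gcongr
        exact integral_sq_pow_le_of_psi2Norm_le hz hK hp
    _ = (2 * K ^ 2 * |l|) ^ p * ((p : ℝ) ^ p / p.factorial) := by
        simp only [mul_pow]
        ring
    _ ≤ (2 * K ^ 2 * |l|) ^ p * 3 ^ p := by
        gcongr
        exact natCast_pow_div_factorial_le_three_pow p
    _ = (6 * K ^ 2 * |l|) ^ p := by
        rw [← mul_pow]
        ring

variable [IsProbabilityMeasure μ]

theorem hasSum_integral_exp_mul_sq (hz : AEStronglyMeasurable z μ) (hK : psi2Norm z μ ≤ K)
    {l : ℝ} (hl : 6 * (K : ℝ) ^ 2 * |l| < 1) :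
    HasSum (fun p : ℕ => ∫ ω, (l * z ω ^ 2) ^ p / p.factorial ∂μ)
      (∫ ω, Real.exp (l * z ω ^ 2) ∂μ) := by
  have hint (p : ℕ) : Integrable (fun ω => (l * z ω ^ 2) ^ p / p.factorial) μ := by
    simp only [mul_pow]
    exact ((integrable_sq_pow_of_psi2Norm_le hz hK p).const_mul _).div_const _
  have hsum : Summable fun p : ℕ => ∫ ω, ‖(l * z ω ^ 2) ^ p / p.factorial‖ ∂μ := by
    refine Summable.of_nonneg_of_le (fun p => integral_nonneg fun _ => norm_nonneg _) (fun p => ?_)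
      (summable_geometric_of_lt_one (by positivity) hl)
    rcases p.eq_zero_or_pos with rfl | hp
    · simp
    · exact integral_abs_pow_div_factorial_le hz hK l hp
  have := hasSum_integral_of_summable_integral_norm hint hsum
  simpa only [Real.exp_eq_exp_ℝ, NormedSpace.exp_eq_tsum_div] using this

theorem integrable_exp_mul_sq (hz : AEStronglyMeasurable z μ) (hK : psi2Norm z μ ≤ K) {l : ℝ}
    (hl : 6 * (K : ℝ) ^ 2 * |l| < 1) : Integrable (fun ω => Real.exp (l * z ω ^ 2)) μ := by
  have h := hasSum_integral_exp_mul_sq hz hK (l := |l|) (by rwa [abs_abs])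
  have hone : (1 : ℝ) ≤ ∫ ω, Real.exp (|l| * z ω ^ 2) ∂μ := by
    simpa using le_hasSum h 0 fun p _ => integral_nonneg fun ω => by positivity
  -- a non-integrable function has integral zero
  have hi : Integrable (fun ω => Real.exp (|l| * z ω ^ 2)) μ :=
    .of_integral_ne_zero (by linarith)
  refine hi.mono (by fun_prop) (.of_forall fun ω => ?_)
  simp only [Real.norm_eq_abs, Real.abs_exp, Real.exp_le_exp]
  gcongr
  exact le_abs_self l

theorem integral_exp_mul_sq_le (hz : AEStronglyMeasurable z μ) (hK : psi2Norm z μ ≤ K)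
    (h2 : ∫ ω, z ω ^ 2 ∂μ = 1) {l : ℝ} (hl : 6 * (K : ℝ) ^ 2 * |l| ≤ 1 / 2) :
    ∫ ω, Real.exp (l * z ω ^ 2) ∂μ ≤ Real.exp (l + 72 * K ^ 4 * l ^ 2) := by
  set a : ℝ := 6 * (K : ℝ) ^ 2 * |l| with ha
  have ha0 : 0 ≤ a := by positivity
  have htail := (hasSum_nat_add_iff' 2).2 (hasSum_integral_exp_mul_sq hz hK (by linarith))
  have hgeom : HasSum (fun p : ℕ => a ^ (p + 2)) (a ^ 2 * (1 - a)⁻¹) := by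
    have := (hasSum_geometric_of_lt_one ha0 (by linarith)).mul_left (a ^ 2)
    simpa only [← pow_add, add_comm 2] using this
  have hle := hasSum_le (fun p => (le_abs_self _).trans (abs_integral_le_integral_abs.trans
    (integral_abs_pow_div_factorial_le hz hK l (by lia)))) htail hgeom
  have hhead : ∑ p ∈ Finset.range 2, ∫ ω, (l * z ω ^ 2) ^ p / p.factorial ∂μ = 1 + l := by
    simp [Finset.sum_range_succ, integral_const_mul, h2]
  have hinv : (1 - a)⁻¹ ≤ 2 := by
    rw [inv_le_comm₀ (by linarith) (by norm_num)]
    linarith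
  have hsq : a ^ 2 * (1 - a)⁻¹ ≤ 72 * K ^ 4 * l ^ 2 := by
    calc a ^ 2 * (1 - a)⁻¹ ≤ a ^ 2 * 2 := by gcongr
      _ = 72 * K ^ 4 * l ^ 2 := by
        rw [ha, mul_pow, sq_abs]
        ring
  linarith [Real.add_one_le_exp (l + 72 * (K : ℝ) ^ 4 * l ^ 2)]

theorem hasSubexponentialMGF_sq_sub_one (hz : AEStronglyMeasurable z μ) (hK1 : 1 ≤ K)
    (hK : psi2Norm z μ ≤ K) (h2 : ∫ ω, z ω ^ 2 ∂μ = 1) :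
    HasSubexponentialMGF (fun ω => z ω ^ 2 - 1) (144 * K ^ 4) (1 / (12 * K ^ 2)) μ := by
  have : (0 : ℝ) < K := by positivity
  have hsplit (t : ℝ) (ω : Ω) :
      Real.exp (t * (z ω ^ 2 - 1)) = Real.exp (t * z ω ^ 2) * Real.exp (-t) := by
    rw [← Real.exp_add]
    ring_nf
  have hsmall {t : ℝ} (ht : |t| ≤ 1 / (12 * K ^ 2)) : 6 * (K : ℝ) ^ 2 * |t| ≤ 1 / 2 := by
    rw [le_div_iff₀ (by positivity)] at ht
    linarith
  refine ⟨fun t ht => ?_, fun t ht => ?_⟩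
  · simp only [hsplit]
    exact (integrable_exp_mul_sq hz hK ((hsmall ht).trans_lt (by norm_num))).mul_const _
  · calc mgf (fun ω => z ω ^ 2 - 1) μ t
        = (∫ ω, Real.exp (t * z ω ^ 2) ∂μ) * Real.exp (-t) := by
          simp only [mgf, hsplit, integral_mul_const]
      _ ≤ Real.exp (t + 72 * K ^ 4 * t ^ 2) * Real.exp (-t) := by
          gcongr
          exact integral_exp_mul_sq_le hz hK h2 (hsmall ht)
      _ = Real.exp (144 * K ^ 4 * t ^ 2 / 2) := by
          rw [← Real.exp_add]
          ring_nf

end SubgaussianSquare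

section Net

open Metric Module

variable {E : Type*} [NormedAddCommGroup E] [NormedSpace ℝ E] [FiniteDimensional ℝ E]

-- Disjoint balls of radius `ε / 2` around the points of `s` fit into a ball of radius `1 + ε / 2`.
theorem card_le_of_isSeparated {ε : ℝ≥0} (hε : 0 < ε) {s : Finset E}
    (hs : (s : Set E) ⊆ closedBall 0 1) (hsep : IsSeparated ε (s : Set E)) :
    (s.card : ℝ) ≤ (1 + 2 / ε) ^ finrank ℝ E := by
  borelize E
  let ν : Measure E := Measure.addHaar
  have hε2 : (0 : ℝ) < ε / 2 := by positivity
  have hdisj : Set.Pairwise (s : Set E) (Function.onFun Disjoint fun c => ball c (ε / 2)) := by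
    intro x hx y hy hxy
    refine ball_disjoint_ball ?_
    have : (ε : ℝ≥0∞) < edist x y := hsep hx hy hxy
    rw [edist_nndist, ENNReal.coe_lt_coe, ← NNReal.coe_lt_coe, coe_nndist] at this
    linarith
  have hsub : (⋃ c ∈ s, ball c (ε / 2 : ℝ)) ⊆ ball (0 : E) (1 + ε / 2) :=
    Set.iUnion₂_subset fun x hx => ball_subset_ball' (by linarith [mem_closedBall.1 (hs hx)])
  have hvol : ENNReal.ofReal (s.card * (ε / 2 : ℝ) ^ finrank ℝ E) * ν (ball 0 1) ≤
      ENNReal.ofReal ((1 + ε / 2 : ℝ) ^ finrank ℝ E) * ν (ball 0 1) :=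
    calc _ = ν (⋃ c ∈ s, ball c (ε / 2)) := by
          rw [measure_biUnion_finset hdisj fun c _ => measurableSet_ball]
          simp only [ν.addHaar_ball_of_pos _ hε2, Finset.sum_const, nsmul_eq_mul, mul_assoc,
            ENNReal.ofReal_mul (Nat.cast_nonneg _), ENNReal.ofReal_natCast]
      _ ≤ ν (ball (0 : E) (1 + ε / 2)) := measure_mono hsub
      _ = _ := ν.addHaar_ball_of_pos _ (by positivity)
  have hcard : (s.card : ℝ) * (ε / 2 : ℝ) ^ finrank ℝ E ≤ (1 + ε / 2 : ℝ) ^ finrank ℝ E := by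
    rwa [ENNReal.mul_le_mul_iff_left (measure_ball_pos _ _ zero_lt_one).ne'
      measure_ball_lt_top.ne, ENNReal.ofReal_le_ofReal_iff (by positivity)] at hvol
  calc (s.card : ℝ) ≤ (1 + ε / 2 : ℝ) ^ finrank ℝ E / (ε / 2 : ℝ) ^ finrank ℝ E :=
        (le_div_iff₀ (by positivity)).2 hcard
    _ = (1 + 2 / ε) ^ finrank ℝ E := by
        rw [← div_pow]
        congr 1
        field_simp
        ring

theorem packingNumber_ne_top_of_totallyBounded {X : Type*} [PseudoEMetricSpace X] {ε : ℝ≥0}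
    (hε : ε ≠ 0) {A : Set X} (hA : TotallyBounded A) : packingNumber ε A ≠ ⊤ := by
  obtain ⟨C, -, hCfin, hC⟩ :=
    exists_finite_isCover_of_totallyBounded (div_ne_zero hε two_ne_zero) hA
  have hle := (packingNumber_two_mul_le_externalCoveringNumber (ε / 2) A).trans
    hC.externalCoveringNumber_le_encard
  rw [mul_div_cancel₀ _ two_ne_zero] at hle
  exact ne_top_of_le_ne_top hCfin.encard_lt_top.ne hle

theorem exists_finset_isCover_card_le {ε : ℝ≥0} (hε : 0 < ε) {A : Set E}
    (hA : A ⊆ closedBall 0 1) :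
    ∃ s : Finset E, (s : Set E) ⊆ A ∧ IsCover ε A s ∧ (s.card : ℝ) ≤ (1 + 2 / ε) ^ finrank ℝ E := by
  have hpack : packingNumber ε A ≠ ⊤ := packingNumber_ne_top_of_totallyBounded hε.ne'
    ((isCompact_closedBall (0 : E) 1).totallyBounded.subset hA)
  have hfin : (maximalSeparatedSet ε A).Finite :=
    Set.encard_ne_top_iff.1 (by rwa [encard_maximalSeparatedSet hpack])
  refine ⟨hfin.toFinset, ?_⟩
  rw [hfin.coe_toFinset]
  exact ⟨maximalSeparatedSet_subset, isCover_maximalSeparatedSet hpack,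
    card_le_of_isSeparated hε (by simpa using maximalSeparatedSet_subset.trans hA)
      (by simpa using isSeparated_maximalSeparatedSet)⟩

end Net

section QuadraticForm

open Metric
open scoped InnerProductSpace

variable {E : Type*} [NormedAddCommGroup E] [InnerProductSpace ℝ E]

theorem opNorm_le_of_abs_inner_self_le {T : E →L[ℝ] E} (hT : T.IsSymmetric) {C : ℝ} (hC : 0 ≤ C)
    (h : ∀ x, ‖x‖ = 1 → |⟪T x, x⟫_ℝ| ≤ C) : ‖T‖ ≤ C := by
  rw [T.norm_eq_iSup_rayleighQuotient hT]
  refine Real.iSup_le (fun x => ?_) hC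
  rcases eq_or_ne x 0 with rfl | hx
  · simpa [ContinuousLinearMap.rayleighQuotient] using hC
  · rw [← T.rayleigh_smul x (inv_ne_zero (norm_ne_zero_iff.2 hx))]
    have hunit : ‖(‖x‖⁻¹ • x)‖ = 1 := norm_smul_inv_norm hx
    simpa [ContinuousLinearMap.rayleighQuotient, hunit, ContinuousLinearMap.reApplyInnerSelf]
      using h _ hunit

theorem abs_inner_self_sub_le (T : E →L[ℝ] E) {x y : E} (hx : ‖x‖ = 1) (hy : ‖y‖ = 1) :
    |⟪T x, x⟫_ℝ - ⟪T y, y⟫_ℝ| ≤ 2 * dist x y * ‖T‖ := by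
  have hdecomp : ⟪T x, x⟫_ℝ - ⟪T y, y⟫_ℝ = ⟪T x, x - y⟫_ℝ + ⟪T (x - y), y⟫_ℝ := by
    rw [map_sub, inner_sub_left, inner_sub_right]
    ring
  calc |⟪T x, x⟫_ℝ - ⟪T y, y⟫_ℝ| ≤ |⟪T x, x - y⟫_ℝ| + |⟪T (x - y), y⟫_ℝ| := by
        rw [hdecomp]
        exact abs_add_le _ _
    _ ≤ ‖T x‖ * ‖x - y‖ + ‖T (x - y)‖ * ‖y‖ :=
        add_le_add (abs_real_inner_le_norm _ _) (abs_real_inner_le_norm _ _)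
    _ ≤ ‖T‖ * ‖x‖ * ‖x - y‖ + ‖T‖ * ‖x - y‖ * ‖y‖ := by
        gcongr <;> exact T.le_opNorm _
    _ = 2 * dist x y * ‖T‖ := by
        rw [hx, hy, dist_eq_norm]
        ring

theorem mul_opNorm_le_of_isCover_sphere {T : E →L[ℝ] E} (hT : T.IsSymmetric) {ε : ℝ≥0} {N : Set E}
    (hN : N ⊆ sphere 0 1) (hcover : IsCover ε (sphere 0 1) N) {C : ℝ} (hC : 0 ≤ C)
    (h : ∀ y ∈ N, |⟪T y, y⟫_ℝ| ≤ C) : (1 - 2 * ε) * ‖T‖ ≤ C := by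
  have hle : ‖T‖ ≤ C + 2 * ε * ‖T‖ := by
    refine opNorm_le_of_abs_inner_self_le hT (by positivity) fun x hx => ?_
    obtain ⟨y, hy, hxy⟩ := Set.mem_iUnion₂.1
      (isCover_iff_subset_iUnion_closedBall.1 hcover (mem_sphere_zero_iff_norm.2 hx))
    have hlip := abs_inner_self_sub_le T hx (mem_sphere_zero_iff_norm.1 (hN hy))
    calc |⟪T x, x⟫_ℝ| ≤ |⟪T y, y⟫_ℝ| + |⟪T x, x⟫_ℝ - ⟪T y, y⟫_ℝ| := by
          linarith [abs_sub_abs_le_abs_sub ⟪T x, x⟫_ℝ ⟪T y, y⟫_ℝ]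
      _ ≤ C + 2 * dist x y * ‖T‖ := add_le_add (h y hy) hlip
      _ ≤ C + 2 * ε * ‖T‖ := by
        gcongr
        exact mem_closedBall.1 hxy
  linarith

end QuadraticForm

section EmpiricalCovariance

open scoped InnerProductSpace

variable {ι E : Type*} [Fintype ι] [NormedAddCommGroup E] [InnerProductSpace ℝ E]

/-- The uncentred empirical covariance operator `(card ι)⁻¹ ∑ i, x i ⊗ x i` of the sample `x`; in
coordinates it is the matrix `n⁻¹ XᵀX`, where `X` has the rows `x i`. -/
def empiricalCovariance (x : ι → E) : E →L[ℝ] E :=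
  (Fintype.card ι : ℝ)⁻¹ • ∑ i, InnerProductSpace.rankOne ℝ (x i) (x i)

theorem inner_empiricalCovariance (x : ι → E) (u v : E) :
    ⟪empiricalCovariance x u, v⟫_ℝ = (Fintype.card ι : ℝ)⁻¹ * ∑ i, ⟪x i, u⟫_ℝ * ⟪x i, v⟫_ℝ := by
  simp [empiricalCovariance, sum_inner, real_inner_smul_left]

theorem isSymmetric_one_sub_empiricalCovariance (x : ι → E) :
    (1 - empiricalCovariance x).IsSymmetric := by
  intro u v
  simp only [ContinuousLinearMap.coe_coe, sub_apply,
    one_apply_eq_self, inner_sub_left,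
    inner_empiricalCovariance, real_inner_comm _ u, mul_comm ⟪x _, u⟫_ℝ]

theorem inner_one_sub_empiricalCovariance_self [Nonempty ι] (x : ι → E) {θ : E} (hθ : ‖θ‖ = 1) :
    ⟪(1 - empiricalCovariance x) θ, θ⟫_ℝ =
      -((Fintype.card ι : ℝ)⁻¹ * ∑ i, (⟪x i, θ⟫_ℝ ^ 2 - 1)) := by
  rw [sub_apply, one_apply_eq_self, inner_sub_left,
    inner_empiricalCovariance, real_inner_self_eq_norm_sq, hθ]
  simp [← sq, mul_sub]

end EmpiricalCovariance

section Deviation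

open Metric
open scoped InnerProductSpace

variable {ι E Ω : Type*} [NormedAddCommGroup E] [InnerProductSpace ℝ E]
  [MeasurableSpace E] [MeasurableSpace Ω] {μ : Measure Ω} {K : ℝ≥0}

/-- Coordinate-free version of the hypotheses on the rows: `x` is a random vector of an inner
product space whose marginals in unit directions have second moment one and sub-gaussian norm at
most `K`. It makes sense inside every subspace, so that rows can be projected. -/
structure IsIsotropicSubgaussian (x : Ω → E) (K : ℝ≥0) (μ : Measure Ω) : Prop where
  measurable : Measurable x
  integral_inner_sq : ∀ θ, ‖θ‖ = 1 → ∫ ω, ⟪x ω, θ⟫_ℝ ^ 2 ∂μ = 1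
  psi2Norm_inner_le : ∀ θ, ‖θ‖ = 1 → psi2Norm (fun ω => ⟪x ω, θ⟫_ℝ) μ ≤ K

theorem measureReal_le_card_mul_of_subset_biUnion [IsFiniteMeasure μ] {β : Type*} {s : Finset β}
    {A : Set Ω} {B : β → Set Ω} (hAB : A ⊆ ⋃ i ∈ s, B i) {C : ℝ} (hC : ∀ i ∈ s, μ.real (B i) ≤ C) :
    μ.real A ≤ s.card * C := by
  calc μ.real A ≤ μ.real (⋃ i ∈ s, B i) := measureReal_mono hAB (measure_ne_top _ _)
    _ ≤ ∑ i ∈ s, μ.real (B i) := measureReal_biUnion_finset_le _ _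
    _ ≤ s.card • C := Finset.sum_le_card_nsmul _ _ _ hC
    _ = s.card * C := nsmul_eq_mul _ _

theorem measurable_orthogonalProjectionOnto [BorelSpace E] (U : Submodule ℝ E)
    [U.HasOrthogonalProjection] : Measurable U.orthogonalProjectionOnto :=
  U.orthogonalProjectionOnto.continuous.measurable

theorem IsIsotropicSubgaussian.orthogonalProjectionOnto [BorelSpace E] {x : Ω → E}
    (hx : IsIsotropicSubgaussian x K μ) (U : Submodule ℝ E) [U.HasOrthogonalProjection] :
    IsIsotropicSubgaussian (fun ω => U.orthogonalProjectionOnto (x ω)) K μ where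
  measurable := (measurable_orthogonalProjectionOnto U).comp hx.measurable
  integral_inner_sq θ hθ := by
    simpa using hx.integral_inner_sq θ hθ
  psi2Norm_inner_le θ hθ := by
    simpa using hx.psi2Norm_inner_le θ hθ

variable [Fintype ι] [Nonempty ι] [IsProbabilityMeasure μ] {x : ι → Ω → E}

theorem measureReal_abs_inner_one_sub_empiricalCovariance_ge_le [OpensMeasurableSpace E]
    (hK1 : 1 ≤ K) (hind : iIndepFun x μ) (hx : ∀ i, IsIsotropicSubgaussian (x i) K μ) {t : ℝ}
    (ht : 0 ≤ t) {θ : E} (hθ : ‖θ‖ = 1) :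
    μ.real {ω | max t (t ^ 2) / 2 ≤ |⟪(1 - empiricalCovariance fun i => x i ω) θ, θ⟫_ℝ|} ≤
      2 * Real.exp (-(Fintype.card ι * t ^ 2 / (1152 * K ^ 4))) := by
  have hK1' : (1 : ℝ) ≤ K := by exact_mod_cast hK1
  have hinner : Measurable fun v : E => ⟪v, θ⟫_ℝ := by fun_prop
  have hmeas (i : ι) : Measurable fun ω => ⟪x i ω, θ⟫_ℝ := hinner.comp (hx i).measurable
  have hindθ : iIndepFun (fun i ω => ⟪x i ω, θ⟫_ℝ ^ 2 - 1) μ :=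
    hind.comp (fun _ v => ⟪v, θ⟫_ℝ ^ 2 - 1) fun _ => by fun_prop
  have hsum : HasSubexponentialMGF (∑ i, fun ω => ⟪x i ω, θ⟫_ℝ ^ 2 - 1)
      (Fintype.card ι * (144 * K ^ 4)) (1 / (12 * K ^ 2)) μ := by
    simpa using HasSubexponentialMGF.sum_of_iIndepFun (s := Finset.univ) hindθ
      (fun i => (hmeas i).pow_const 2 |>.sub_const 1) fun i _ =>
        hasSubexponentialMGF_sq_sub_one (hmeas i).aestronglyMeasurable hK1
          ((hx i).psi2Norm_inner_le θ hθ) ((hx i).integral_inner_sq θ hθ)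
  have hab : 1 / (288 * K ^ 4 : ℝ) ≤ 1 / (12 * K ^ 2) := by
    gcongr <;> norm_num
  have hva : 2 * (144 * K ^ 4) * (1 / (288 * K ^ 4 : ℝ)) ≤ 1 := by
    field_simp
    norm_num
  convert hsum.measureReal_abs_ge_max_sq_le (Nat.cast_nonneg _) (by positivity) hab hva ht using 3
  · ext ω
    simp only [inner_one_sub_empiricalCovariance_self _ hθ, Finset.sum_apply, abs_neg, abs_mul,
      abs_inv, Nat.abs_cast]
    rw [le_inv_mul_iff₀ (by positivity)]
  · field_simp
    ring

theorem measureReal_norm_one_sub_empiricalCovariance_gt_le [OpensMeasurableSpace E]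
    [FiniteDimensional ℝ E] (hK1 : 1 ≤ K) (hind : iIndepFun x μ)
    (hx : ∀ i, IsIsotropicSubgaussian (x i) K μ) {t : ℝ} (ht : 0 ≤ t) :
    μ.real {ω | max t (t ^ 2) < ‖1 - empiricalCovariance fun i => x i ω‖} ≤
      9 ^ Module.finrank ℝ E * (2 * Real.exp (-(Fintype.card ι * t ^ 2 / (1152 * K ^ 4)))) := by
  obtain ⟨N, hN, hcover, hcard⟩ := exists_finset_isCover_card_le (ε := 1 / 4) (by norm_num)
    (sphere_subset_closedBall (x := (0 : E)) (ε := 1))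
  have hcard9 : (N.card : ℝ) ≤ 9 ^ Module.finrank ℝ E :=
    hcard.trans_eq (by norm_num)
  have hsub : {ω | max t (t ^ 2) < ‖1 - empiricalCovariance fun i => x i ω‖} ⊆
      ⋃ y ∈ N, {ω | max t (t ^ 2) / 2 ≤
        |⟪(1 - empiricalCovariance fun i => x i ω) y, y⟫_ℝ|} := by
    intro ω hω
    by_contra hfar
    simp only [Set.mem_iUnion, Set.mem_ofPred_eq, not_exists, not_le] at hω hfar
    have hnet := mul_opNorm_le_of_isCover_sphere
      (isSymmetric_one_sub_empiricalCovariance fun i => x i ω) hN hcover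
      (C := max t (t ^ 2) / 2) (by positivity) fun y hy => (hfar y hy).le
    have hquarter : (1 - 2 * ((1 / 4 : ℝ≥0) : ℝ)) = 1 / 2 := by norm_num
    rw [hquarter] at hnet
    linarith
  refine (measureReal_le_card_mul_of_subset_biUnion hsub fun y hy =>
    measureReal_abs_inner_one_sub_empiricalCovariance_ge_le hK1 hind hx ht
      (mem_sphere_zero_iff_norm.1 (hN hy))).trans ?_
  gcongr

theorem measureReal_exists_norm_one_sub_empiricalCovariance_gt_le [BorelSpace E]
    [FiniteDimensional ℝ E] (hK1 : 1 ≤ K) (hind : iIndepFun x μ)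
    (hx : ∀ i, IsIsotropicSubgaussian (x i) K μ) {t : ℝ} (ht : 0 ≤ t)
    {𝒲 : Set (Submodule ℝ E)} (h𝒲 : 𝒲.Finite) {k : ℕ} (hk : ∀ U ∈ 𝒲, Module.finrank ℝ U ≤ k) :
    μ.real {ω | ∃ U ∈ 𝒲, max t (t ^ 2) <
        ‖1 - empiricalCovariance fun i => U.orthogonalProjectionOnto (x i ω)‖} ≤
      𝒲.ncard * (9 ^ k * (2 * Real.exp (-(Fintype.card ι * t ^ 2 / (1152 * K ^ 4))))) := by
  lift 𝒲 to Finset (Submodule ℝ E) using h𝒲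
  have hsub : {ω | ∃ U ∈ (𝒲 : Set (Submodule ℝ E)), max t (t ^ 2) <
        ‖1 - empiricalCovariance fun i => U.orthogonalProjectionOnto (x i ω)‖} ⊆
      ⋃ U ∈ 𝒲, {ω | max t (t ^ 2) <
        ‖1 - empiricalCovariance fun i => U.orthogonalProjectionOnto (x i ω)‖} := by
    rintro ω ⟨U, hU, hlt⟩
    exact Set.mem_biUnion hU hlt
  rw [Set.ncard_coe_finset]
  refine measureReal_le_card_mul_of_subset_biUnion hsub fun U hU => ?_
  have hindU : iIndepFun (fun i ω => U.orthogonalProjectionOnto (x i ω)) μ :=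
    hind.comp (fun _ => U.orthogonalProjectionOnto)
      fun _ => measurable_orthogonalProjectionOnto U
  refine (measureReal_norm_one_sub_empiricalCovariance_gt_le hK1 hindU
    (fun i => (hx i).orthogonalProjectionOnto U) ht).trans ?_
  gcongr
  · norm_num
  · exact hk U hU

end Deviation

section Design

open scoped InnerProductSpace

variable {n d m : ℕ} {U : Submodule ℝ (EuclideanSpace ℝ (Fin d))}

theorem IsIsotropic.integral_inner_sq {Ω : Type*} [MeasurableSpace Ω] {μ : Measure Ω}
    {x : Ω → EuclideanSpace ℝ (Fin d)} (hx : IsIsotropic x μ) (θ : EuclideanSpace ℝ (Fin d)) :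
    ∫ ω, ⟪x ω, θ⟫_ℝ ^ 2 ∂μ = ‖θ‖ ^ 2 := by
  have hexp (ω : Ω) : ⟪x ω, θ⟫_ℝ ^ 2 = ∑ j, ∑ k, θ j * θ k * (x ω j * x ω k) := by
    rw [sq, PiLp.inner_apply, Finset.sum_mul_sum]
    refine Finset.sum_congr rfl fun j _ => Finset.sum_congr rfl fun k _ => ?_
    simp only [RCLike.inner_apply, conj_trivial]
    ring
  simp only [hexp]
  rw [integral_finsetSum _ fun j _ => integrable_finsetSum _ fun k _ => (hx j k).1.const_mul _,
    EuclideanSpace.norm_sq_eq]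
  refine Finset.sum_congr rfl fun j _ => ?_
  rw [integral_finsetSum _ fun k _ => (hx j k).1.const_mul _]
  simp [integral_const_mul, (hx j _).2, Matrix.one_apply, sq]

theorem IsIsotropic.isIsotropicSubgaussian {Ω : Type*} [MeasurableSpace Ω] {μ : Measure Ω}
    {x : Ω → EuclideanSpace ℝ (Fin d)} (hx : IsIsotropic x μ) (hmeas : Measurable x) {K : ℝ≥0}
    (hK : vectorPsi2Norm x μ ≤ K) : IsIsotropicSubgaussian x K μ where
  measurable := hmeas
  integral_inner_sq θ hθ := by rw [hx.integral_inner_sq, hθ, one_pow]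
  psi2Norm_inner_le θ hθ :=
    (le_iSup₂ (f := fun (θ : EuclideanSpace ℝ (Fin d)) (_ : ‖θ‖ = 1) =>
      psi2Norm (fun ω => ⟪x ω, θ⟫_ℝ) μ) θ hθ).trans hK

theorem basisMatrix_mulVec (b : OrthonormalBasis (Fin m) ℝ U) (v : EuclideanSpace ℝ (Fin m)) :
    (basisMatrix b).mulVec v.ofLp = (b.repr.symm v : EuclideanSpace ℝ (Fin d)).ofLp := by
  ext i
  rw [← b.sum_repr_symm]
  simp [basisMatrix, Matrix.mulVec, dotProduct, mul_comm]

theorem designMatrix_mul_basisMatrix_mulVec (x : Fin n → EuclideanSpace ℝ (Fin d))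
    (b : OrthonormalBasis (Fin m) ℝ U) (v : EuclideanSpace ℝ (Fin m)) :
    (designMatrix x * basisMatrix b).mulVec v.ofLp =
      fun i => ⟪U.orthogonalProjectionOnto (x i), b.repr.symm v⟫_ℝ := by
  ext i
  rw [← Matrix.mulVec_mulVec, basisMatrix_mulVec,
    Submodule.inner_orthogonalProjectionOnto_eq_of_mem_right]
  simp [designMatrix, Matrix.mulVec, dotProduct, PiLp.inner_apply, mul_comm]

theorem inner_toEuclideanCLM_one_sub_gram (x : Fin n → EuclideanSpace ℝ (Fin d))
    (b : OrthonormalBasis (Fin m) ℝ U) (v w : EuclideanSpace ℝ (Fin m)) :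
    ⟪Matrix.toEuclideanCLM (𝕜 := ℝ) (1 - (1 / (n : ℝ)) •
        ((designMatrix x * basisMatrix b).transpose * (designMatrix x * basisMatrix b))) v, w⟫_ℝ =
      ⟪(1 - empiricalCovariance fun i => U.orthogonalProjectionOnto (x i)) (b.repr.symm v),
        b.repr.symm w⟫_ℝ := by
  set A := designMatrix x * basisMatrix b with hA
  rw [sub_apply, inner_sub_left, inner_empiricalCovariance, one_apply_eq_self,
    LinearIsometryEquiv.inner_map_map]
  rw [EuclideanSpace.inner_eq_star_dotProduct, EuclideanSpace.inner_eq_star_dotProduct v w]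
  simp only [star_trivial, Matrix.ofLp_toEuclideanCLM]
  rw [Matrix.sub_mulVec, Matrix.one_mulVec, Matrix.smul_mulVec, ← Matrix.mulVec_mulVec,
    dotProduct_sub, dotProduct_smul, Matrix.mulVec_transpose, dotProduct_comm _ (Matrix.vecMul _ _),
    ← Matrix.dotProduct_mulVec, hA,
    designMatrix_mul_basisMatrix_mulVec, designMatrix_mul_basisMatrix_mulVec]
  simp [dotProduct]

theorem norm_one_sub_gram_le (x : Fin n → EuclideanSpace ℝ (Fin d))
    (b : OrthonormalBasis (Fin m) ℝ U) :
    ‖(1 : Matrix (Fin m) (Fin m) ℝ) - (1 / (n : ℝ)) •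
        ((basisMatrix b).transpose * (designMatrix x).transpose * designMatrix x *
          basisMatrix b)‖ ≤
      ‖1 - empiricalCovariance fun i => U.orthogonalProjectionOnto (x i)‖ := by
  rw [Matrix.mul_assoc _ (designMatrix x), ← Matrix.transpose_mul, Matrix.cstar_norm_def]
  refine ContinuousLinearMap.opNorm_le_of_re_inner_le (norm_nonneg _) fun v w hv hw => ?_
  rw [RCLike.re_to_real, inner_toEuclideanCLM_one_sub_gram]
  refine (real_inner_le_norm _ _).trans ?_
  rw [b.repr.symm.norm_map w, hw, mul_one]
  exact ContinuousLinearMap.unit_le_opNorm _ _ (by rw [b.repr.symm.norm_map, hv])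

theorem norm_le_of_norm_one_sub_gram_le {A : Matrix (Fin n) (Fin m) ℝ} (hn : n ≠ 0) {t : ℝ}
    (ht : 0 ≤ t) (hA : ‖1 - (1 / (n : ℝ)) • (A.transpose * A)‖ ≤ max t (t ^ 2)) :
    1 / √(n : ℝ) * ‖A‖ ≤ 1 + t := by
  have hn0 : (0 : ℝ) < n := by positivity
  have hsq : (1 / √(n : ℝ) * ‖A‖) ^ 2 = ‖(1 / (n : ℝ)) • (A.transpose * A)‖ := by
    rw [← Matrix.conjTranspose_eq_transpose_of_trivial, norm_smul,
      Matrix.l2_opNorm_conjTranspose_mul_self, mul_pow, div_pow, Real.sq_sqrt hn0.le,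
      Real.norm_of_nonneg (by positivity), one_pow, sq ‖A‖]
  have hone : ‖(1 : Matrix (Fin m) (Fin m) ℝ)‖ ≤ 1 := by
    rw [Matrix.cstar_norm_def, map_one]
    exact ContinuousLinearMap.norm_id_le
  refine le_of_sq_le_sq ?_ (by positivity)
  calc (1 / √(n : ℝ) * ‖A‖) ^ 2 = ‖(1 / (n : ℝ)) • (A.transpose * A)‖ := hsq
    _ = ‖1 - (1 - (1 / (n : ℝ)) • (A.transpose * A))‖ := by rw [sub_sub_cancel]
    _ ≤ 1 + max t (t ^ 2) := (norm_sub_le _ _).trans (add_le_add hone hA)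
    _ ≤ (1 + t) ^ 2 := by
      have : max t (t ^ 2) ≤ 2 * t + t ^ 2 := max_le (by nlinarith) (by nlinarith)
      linarith

theorem norm_designMatrix_mul_basisMatrix_le (hn : n ≠ 0) (x : Fin n → EuclideanSpace ℝ (Fin d))
    (b : OrthonormalBasis (Fin m) ℝ U) {t : ℝ} (ht : 0 ≤ t)
    (h : ‖1 - empiricalCovariance fun i => U.orthogonalProjectionOnto (x i)‖ ≤ max t (t ^ 2)) :
    1 / √(n : ℝ) * ‖designMatrix x * basisMatrix b‖ ≤ 1 + t := by
  refine norm_le_of_norm_one_sub_gram_le hn ht ?_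
  rw [Matrix.transpose_mul, ← Matrix.mul_assoc]
  exact (norm_one_sub_gram_le x b).trans h

end Design

section Radius

/-- The radius `δ_p` for an arbitrary family of `N` subspaces of dimension at most `D`; `delta` is
its value for the family `E1 d Q`. -/
def deviationRadius (C₀ c : ℝ) (D N n p : ℕ) : ℝ :=
  C₀ * √((p * D : ℝ) / n) + √((1 + p * Real.log N) / (c * n))

theorem deviationRadius_nonneg {C₀ : ℝ} (hC₀ : 0 ≤ C₀) (c : ℝ) (D N n p : ℕ) :
    0 ≤ deviationRadius C₀ c D N n p := by
  unfold deviationRadius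
  positivity

theorem sq_add_sq_add_sq_le_add_sq {u v w : ℝ} (hu : 0 ≤ u) (hv : 0 ≤ v) (hw : 0 ≤ w) :
    u ^ 2 + v ^ 2 + w ^ 2 ≤ (u + v + w) ^ 2 := by
  nlinarith [mul_nonneg hu hv, mul_nonneg hu hw, mul_nonneg hv hw]

theorem entropy_add_le_mul_sq_deviationRadius_add {a : ℝ} (ha : 0 < a) (D N p : ℕ) {n : ℕ}
    (hn : n ≠ 0) {ε : ℝ} (hε : 0 ≤ ε) :
    p * D * Real.log 9 + p * Real.log N + 2 + a / 2 * ε ^ 2 * n ≤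
      a * n * (deviationRadius √(Real.log 9 / a) (a / 2) D N n p + ε) ^ 2 := by
  have : (0 : ℝ) < n := by positivity
  have : 0 ≤ Real.log N := Real.log_natCast_nonneg N
  have : 0 ≤ Real.log 9 := Real.log_nonneg (by norm_num)
  set u := √(Real.log 9 / a) * √((p * D : ℝ) / n) with hu
  set v := √((1 + p * Real.log N) / (a / 2 * n)) with hv
  have husq : a * n * u ^ 2 = p * D * Real.log 9 := by
    rw [hu, mul_pow, Real.sq_sqrt (by positivity), Real.sq_sqrt (by positivity)]
    field_simp
  have hvsq : a * n * v ^ 2 = 2 * (1 + p * Real.log N) := by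
    rw [hv, Real.sq_sqrt (by positivity)]
    field_simp
  have hslack : 0 ≤ p * Real.log N + a / 2 * ε ^ 2 * n := by positivity
  calc p * D * Real.log 9 + p * Real.log N + 2 + a / 2 * ε ^ 2 * n
      ≤ a * n * u ^ 2 + a * n * v ^ 2 + a * n * ε ^ 2 := by linarith
    _ = a * n * (u ^ 2 + v ^ 2 + ε ^ 2) := by ring
    _ ≤ a * n * (u + v + ε) ^ 2 := by
      gcongr
      exact sq_add_sq_add_sq_le_add_sq (by positivity) (by positivity) hε

theorem two_mul_exp_neg_two_le : 2 * Real.exp (-2) ≤ 1 / 2 := by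
  have hexp : (2 : ℝ) ^ 2 ≤ Real.exp 2 := by
    calc (2 : ℝ) ^ 2 ≤ Real.exp 1 ^ 2 := by
          gcongr
          linarith [Real.add_one_le_exp (1 : ℝ)]
      _ = Real.exp 2 := by rw [← Real.exp_nat_mul]; norm_num
  rw [Real.exp_neg, ← div_eq_mul_inv, div_le_div_iff₀ (Real.exp_pos 2) two_pos]
  linarith

theorem pow_mul_pow_mul_exp_neg_le (D N p : ℕ) {s y : ℝ}
    (h : p * D * Real.log 9 + p * Real.log N + 2 + s ≤ y) :
    (N : ℝ) ^ p * (9 ^ (p * D) * (2 * Real.exp (-y))) ≤ Real.exp (-s) / 2 := by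
  have hN : (N : ℝ) ^ p ≤ Real.exp (p * Real.log N) := by
    rw [Real.exp_nat_mul]
    gcongr
    exact Real.le_exp_log _
  have h9 : (9 : ℝ) ^ (p * D) = Real.exp (p * D * Real.log 9) := by
    rw [← Nat.cast_mul, Real.exp_nat_mul, Real.exp_log (by norm_num)]
  rw [h9]
  calc (N : ℝ) ^ p * (Real.exp (p * D * Real.log 9) * (2 * Real.exp (-y)))
      ≤ Real.exp (p * Real.log N) * (Real.exp (p * D * Real.log 9) *
          (2 * Real.exp (-(p * D * Real.log 9 + p * Real.log N + 2 + s)))) := by gcongr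
    _ = 2 * Real.exp (-2) * Real.exp (-s) := by
      simp only [neg_add, Real.exp_add, Real.exp_neg (_ * _)]
      field_simp
    _ ≤ 1 / 2 * Real.exp (-s) := by
      gcongr
      exact two_mul_exp_neg_two_le
    _ = Real.exp (-s) / 2 := by ring

end Radius

section Sups

open Module
open scoped SetFamily

theorem finite_sups {α : Type*} [SemilatticeSup α] {s t : Set α} (hs : s.Finite) (ht : t.Finite) :
    (s ⊻ t).Finite :=
  hs.image2 _ ht

theorem ncard_sups_le {α : Type*} [SemilatticeSup α] {s t : Set α} (hs : s.Finite)
    (ht : t.Finite) : (s ⊻ t).ncard ≤ s.ncard * t.ncard := by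
  rw [← Set.image_sup_prod, ← Set.image_prod, ← Set.ncard_prod]
  exact Set.ncard_image_le (hs.prod ht)

theorem finrank_le_add_of_mem_sups {𝕜 V : Type*} [DivisionRing 𝕜] [AddCommGroup V] [Module 𝕜 V]
    [FiniteDimensional 𝕜 V] {𝒰 𝒱 : Set (Submodule 𝕜 V)} {k l : ℕ} (h𝒰 : ∀ U ∈ 𝒰, finrank 𝕜 U ≤ k)
    (h𝒱 : ∀ U ∈ 𝒱, finrank 𝕜 U ≤ l) :
    ∀ U ∈ 𝒰 ⊻ 𝒱, finrank 𝕜 U ≤ k + l := by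
  rintro _ ⟨U, hU, V, hV, rfl⟩
  exact (Submodule.finrank_add_le_finrank_add_finrank U V).trans
    (add_le_add (h𝒰 U hU) (h𝒱 V hV))

variable {d Q : ℕ}

theorem E2_eq_sups : E2 d Q = E1 d Q ⊻ E1 d Q := by
  ext U
  simp only [E2, E1, Set.mem_sups, Set.mem_ofPred_eq]
  grind

theorem E3_eq_sups : E3 d Q = E1 d Q ⊻ E1 d Q ⊻ E1 d Q := by
  ext U
  simp only [E3, E1, Set.mem_sups, Set.mem_ofPred_eq]
  grind

theorem finrank_le_maxDim : ∀ U ∈ E1 d Q, finrank ℝ U ≤ maxDim d Q := fun U hU =>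
  le_csSup ((E1_finite d Q).image _).bddAbove ⟨U, hU, rfl⟩

end Sups

section UniformDeviation

open scoped SetFamily

variable {ι E Ω : Type*} [Fintype ι] [Nonempty ι] [NormedAddCommGroup E] [InnerProductSpace ℝ E]
  [FiniteDimensional ℝ E] [MeasurableSpace E] [BorelSpace E] [MeasurableSpace Ω] {μ : Measure Ω}
  [IsProbabilityMeasure μ] {x : ι → Ω → E} {K : ℝ≥0} {a ε : ℝ} {D : ℕ}

theorem measureReal_exists_norm_gt_deviationRadius_add_le (hK1 : 1 ≤ K) (hind : iIndepFun x μ)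
    (hx : ∀ i, IsIsotropicSubgaussian (x i) K μ) (ha0 : 0 < a) (haK : a ≤ 1 / (1152 * K ^ 4))
    {𝒲 : Set (Submodule ℝ E)} (h𝒲 : 𝒲.Finite) {N p : ℕ} (hcard : 𝒲.ncard ≤ N ^ p)
    (hdim : ∀ U ∈ 𝒲, Module.finrank ℝ U ≤ p * D) (hε : 0 ≤ ε) {t : ℝ}
    (ht : t = deviationRadius √(Real.log 9 / a) (a / 2) D N (Fintype.card ι) p + ε) :
    μ.real {ω | ∃ U ∈ 𝒲, max t (t ^ 2) <
        ‖1 - empiricalCovariance fun i => U.orthogonalProjectionOnto (x i ω)‖} ≤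
      Real.exp (-(a / 2 * ε ^ 2 * Fintype.card ι)) / 2 := by
  have ht0 : 0 ≤ t := by
    rw [ht]
    exact add_nonneg (deviationRadius_nonneg (Real.sqrt_nonneg _) _ _ _ _ _) hε
  have hrate : a * Fintype.card ι * t ^ 2 ≤ Fintype.card ι * t ^ 2 / (1152 * K ^ 4) := by
    calc a * Fintype.card ι * t ^ 2 ≤ 1 / (1152 * K ^ 4) * Fintype.card ι * t ^ 2 := by gcongr
      _ = Fintype.card ι * t ^ 2 / (1152 * K ^ 4) := by ring
  have hentropy := entropy_add_le_mul_sq_deviationRadius_add ha0 D N p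
    (n := Fintype.card ι) Fintype.card_ne_zero hε
  rw [← ht] at hentropy
  refine (measureReal_exists_norm_one_sub_empiricalCovariance_gt_le hK1 hind hx ht0 h𝒲
    hdim).trans (le_trans ?_ (pow_mul_pow_mul_exp_neg_le D N p (hentropy.trans hrate)))
  gcongr
  exact_mod_cast hcard

theorem one_sub_add_le_measureReal_of_compl_subset_union {S F G : Set Ω} (h : Sᶜ ⊆ F ∪ G)
    {p q : ℝ} (hF : μ.real F ≤ p) (hG : μ.real G ≤ q) : 1 - (p + q) ≤ μ.real S := by
  have htotal : 1 ≤ μ.real S + μ.real (F ∪ G) :=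
    calc (1 : ℝ) = μ.real (S ∪ (F ∪ G)) := by
          rw [Set.compl_subset_iff_union.1 h, probReal_univ]
      _ ≤ μ.real S + μ.real (F ∪ G) := measureReal_union_le _ _
  linarith [measureReal_union_le (μ := μ) F G]

theorem one_sub_exp_le_measureReal_forall_norm_le (hK1 : 1 ≤ K) (hind : iIndepFun x μ)
    (hx : ∀ i, IsIsotropicSubgaussian (x i) K μ) (ha0 : 0 < a) (haK : a ≤ 1 / (1152 * K ^ 4))
    {𝒰 : Set (Submodule ℝ E)} (h𝒰 : 𝒰.Finite) (hD : ∀ U ∈ 𝒰, Module.finrank ℝ U ≤ D)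
    (hε : 0 ≤ ε) {t : ℕ → ℝ} (ht : ∀ p, t p =
      deviationRadius √(Real.log 9 / a) (a / 2) D 𝒰.ncard (Fintype.card ι) p + ε) :
    1 - Real.exp (-(a / 2 * ε ^ 2 * Fintype.card ι)) ≤ μ.real {ω |
      (∀ U ∈ 𝒰 ⊻ 𝒰, ‖1 - empiricalCovariance fun i => U.orthogonalProjectionOnto (x i ω)‖ ≤
        max (t 2) (t 2 ^ 2)) ∧
      (∀ U ∈ 𝒰 ⊻ 𝒰 ⊻ 𝒰,
        ‖1 - empiricalCovariance fun i => U.orthogonalProjectionOnto (x i ω)‖ ≤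
          max (t 3) (t 3 ^ 2))} := by
  have hcard2 : (𝒰 ⊻ 𝒰).ncard ≤ 𝒰.ncard ^ 2 := (ncard_sups_le h𝒰 h𝒰).trans_eq (sq _).symm
  have hcard3 : (𝒰 ⊻ 𝒰 ⊻ 𝒰).ncard ≤ 𝒰.ncard ^ 3 :=
    (ncard_sups_le (finite_sups h𝒰 h𝒰) h𝒰).trans (Nat.mul_le_mul_right _ hcard2)
  have hdim2 : ∀ U ∈ 𝒰 ⊻ 𝒰, Module.finrank ℝ U ≤ 2 * D := by
    simpa only [two_mul] using finrank_le_add_of_mem_sups hD hD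
  have hdim3 : ∀ U ∈ 𝒰 ⊻ 𝒰 ⊻ 𝒰, Module.finrank ℝ U ≤ 3 * D := by
    simpa only [Nat.succ_mul] using finrank_le_add_of_mem_sups hdim2 hD
  rw [← add_halves (Real.exp _)]
  refine one_sub_add_le_measureReal_of_compl_subset_union (fun ω hω => ?_)
    (measureReal_exists_norm_gt_deviationRadius_add_le hK1 hind hx ha0 haK
      (finite_sups h𝒰 h𝒰) hcard2 hdim2 hε (ht 2))
    (measureReal_exists_norm_gt_deviationRadius_add_le hK1 hind hx ha0 haK
      (finite_sups (finite_sups h𝒰 h𝒰) h𝒰) hcard3 hdim3 hε (ht 3))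
  simpa only [Set.mem_compl_iff, Set.mem_union, Set.mem_ofPred_eq, not_and_or, not_forall,
    not_le, exists_prop] using hω

end UniformDeviation

end ClusteredDesign

end

open scoped SetFamily in
theorem proposition2_general (K : ℝ≥0) :
    ∃ C₀ c : ℝ, 0 < C₀ ∧ 0 < c ∧
      ∀ (d n : ℕ), 1 ≤ n →
      ∀ 𝒰 : Set (Submodule ℝ (EuclideanSpace ℝ (Fin d))), 𝒰.Finite →
      ∀ D : ℕ, (∀ U ∈ 𝒰, Module.finrank ℝ U ≤ D) →
      ∀ (Ω : Type u) [MeasurableSpace Ω] (μ : Measure Ω) [IsProbabilityMeasure μ]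
        (x : Fin n → Ω → EuclideanSpace ℝ (Fin d)),
        (∀ i, Measurable (x i)) →
        iIndepFun x μ →
        (∀ i, IsIsotropic (x i) μ) →
        (∀ i, vectorPsi2Norm (x i) μ ≤ K) →
        ∀ ε : ℝ, 0 ≤ ε →
          1 - Real.exp (-c * ε ^ 2 * n) ≤ μ.real {ω |
            (∀ U ∈ 𝒰 ⊻ 𝒰, ∀ (m : ℕ) (b : OrthonormalBasis (Fin m) ℝ U),
              1 / √(n : ℝ) * ‖designMatrix (fun i => x i ω) * basisMatrix b‖
                ≤ 1 + deviationRadius C₀ c D 𝒰.ncard n 2 + ε) ∧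
            (∀ U ∈ 𝒰 ⊻ 𝒰 ⊻ 𝒰, ∀ (m : ℕ) (b : OrthonormalBasis (Fin m) ℝ U),
              ‖(1 : Matrix (Fin m) (Fin m) ℝ) - (1 / (n : ℝ)) •
                  ((basisMatrix b).transpose * (designMatrix (fun i => x i ω)).transpose *
                    designMatrix (fun i => x i ω) * basisMatrix b)‖
                ≤ max (deviationRadius C₀ c D 𝒰.ncard n 3 + ε)
                    ((deviationRadius C₀ c D 𝒰.ncard n 3 + ε) ^ 2))} := by
  set L : ℝ≥0 := max K 1
  have hL1 : 1 ≤ L := le_max_right _ _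
  set a : ℝ := 1 / (1152 * L ^ 4)
  have ha0 : 0 < a := by positivity
  have hC₀ : 0 < √(Real.log 9 / a) := Real.sqrt_pos.2 (div_pos (Real.log_pos (by norm_num)) ha0)
  refine ⟨√(Real.log 9 / a), a / 2, hC₀, by positivity, ?_⟩
  intro d n hn 𝒰 h𝒰 D hD Ω _ μ _ x hmeas hind hiso hK ε hε
  have hn0 : n ≠ 0 := (zero_lt_one.trans_le hn).ne'
  have : NeZero n := ⟨hn0⟩
  have hx (i) : IsIsotropicSubgaussian (x i) L μ := (hiso i).isIsotropicSubgaussian (hmeas i)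
    ((hK i).trans (ENNReal.coe_le_coe.2 (le_max_left _ _)))
  have hdev := one_sub_exp_le_measureReal_forall_norm_le hL1 hind hx ha0 le_rfl h𝒰 hD hε
    fun _ => rfl
  rw [Fintype.card_fin, ← neg_mul, ← neg_mul] at hdev
  refine hdev.trans (measureReal_mono fun ω hω => ⟨fun U hU m b => ?_, fun U hU m b => ?_⟩)
  · rw [add_assoc]
    exact norm_designMatrix_mul_basisMatrix_le hn0 _ b
      (add_nonneg (deviationRadius_nonneg hC₀.le _ _ _ _ _) hε) (hω.1 U hU)
  · exact (norm_one_sub_gram_le _ b).trans (hω.2 U hU)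

theorem proposition2 (K : ℝ≥0) :
    ∃ C₀ c : ℝ, 0 < C₀ ∧ 0 < c ∧
      ∀ (d Q n : ℕ), 1 ≤ Q → Q ≤ d → 1 ≤ n →
      ∀ (Ω : Type u) [MeasurableSpace Ω] (μ : Measure Ω) [IsProbabilityMeasure μ]
        (x : Fin n → Ω → EuclideanSpace ℝ (Fin d)),
        (∀ i, Measurable (x i)) →
        iIndepFun x μ →
        (∀ i, IsIsotropic (x i) μ) →
        (∀ i, vectorPsi2Norm (x i) μ ≤ K) →
        ∀ ε : ℝ, 0 ≤ ε →
          1 - Real.exp (-c * ε ^ 2 * n) ≤ μ.real {ω |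
            (∀ U ∈ E2 d Q, ∀ (m : ℕ) (b : OrthonormalBasis (Fin m) ℝ U),
              1 / √(n : ℝ) * ‖designMatrix (fun i => x i ω) * basisMatrix b‖
                ≤ 1 + delta C₀ c d Q n 2 + ε) ∧
            (∀ U ∈ E3 d Q, ∀ (m : ℕ) (b : OrthonormalBasis (Fin m) ℝ U),
              ‖(1 : Matrix (Fin m) (Fin m) ℝ) - (1 / (n : ℝ)) •
                  ((basisMatrix b).transpose * (designMatrix (fun i => x i ω)).transpose *
                    designMatrix (fun i => x i ω) * basisMatrix b)‖
                ≤ 3 * max (delta C₀ c d Q n 3 + ε) ((delta C₀ c d Q n 3 + ε) ^ 2))} := by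
  obtain ⟨C₀, c, hC₀, hc, h⟩ := proposition2_general K
  refine ⟨C₀, c, hC₀, hc, fun d Q n _ _ hn Ω _ μ _ x hmeas hind hiso hK ε hε => ?_⟩
  refine (h d n hn (E1 d Q) (E1_finite d Q) (maxDim d Q) finrank_le_maxDim Ω μ x hmeas hind hiso hK
    ε hε).trans (measureReal_mono fun ω hω => ⟨fun U hU => hω.1 U (E2_eq_sups ▸ hU),
      fun U hU m b => (hω.2 U (E3_eq_sups ▸ hU) m b).trans ?_⟩)
  exact le_mul_of_one_le_left (le_max_of_le_right (sq_nonneg _)) (by norm_num)
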